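/- Let $\mathcal Q$ be any (finite or infinite, possibly empty) set of primes. Let $\mathbb A_{\mathcal Q}$ be the set of all $(x_\infty,(x_p)_{p\in\mathcal Q})\in\mathbb R\times\prod_{p\in\mathcal Q}\mathbb Q_p$ with $x_p\in\mathbb Z_p$ for all but finitely many $p$, with componentwise addition and the restricted product topology with respect to the $\mathbb Z_p$. Let $\Gamma_{\mathcal Q}=\mathbb Z[1/p:p\in\mathcal Q]\subseteq\mathbb Q$, embedded in $\mathbb A_{\mathcal Q}$ by $\gamma\mapsto(\gamma,\gamma,\gamma,\dots)$, and let $X_{\mathcal Q}=\mathbb A_{\mathcal Q}/\Gamma_{\mathcal Q}$, a compact abelian group with Haar probability measure $|\cdot|$. For $\alpha\in X_{\mathcal Q}$, a finite family $A=(A_1,\dots,A_k)$, $k\ge 0$, of measurable subsets of $X_{\mathcal Q}$ (a multiset), with $\chi_A=\sum_i\chi_{A_i}$ and volume $|A|=\sum_i|A_i|$, is called a bounded remainder set for the rotation $x\mapsto x+\alpha$ if there is a constant $C=C(A)>0$ such that, for almost every $x\in X_{\mathcal Q}$ and every $N\in\mathbb N$, $$\Bigl|\sum_{n=0}^{N-1}\chi_A(x+n\alpha)-N|A|\Bigr|\le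 C.$$ For $x=\sum_{i\ge -N}b_ip^i\in\mathbb Q_p$ with digits $b_i\in\{0,\dots,p-1\}$ and $N\ge 0$, let $\{x\}_p=\sum_{-N\le i<0}b_ip^i\in\mathbb Q$ be its $p$-adic fractional part. **Theorem.** Let $\alpha\in X_{\mathcal Q}$ be the class of $(\alpha_\infty,(\alpha_p)_{p\in\mathcal Q})\in\mathbb A_{\mathcal Q}$, and suppose that $\alpha_\infty$ is irrational. Then the set of all volumes $|A|$ of bounded remainder sets $A$ (multisets allowed) for the rotation $x\mapsto x+\alpha$ of $X_{\mathcal Q}$ is exactly the set of those real numbers $$-\gamma\alpha_\infty+\sum_{p\in\mathcal Q}\{\gamma\alpha_p\}_p+n,\qquad \gamma\in\Gamma_{\mathcal Q},\ n\in\mathbb Z,$$ that are $\ge 0$. -/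

import Mathlib

open MeasureTheory RestrictedProduct

noncomputable section

namespace AdelicBRS

/-! ### The `p`-adic fractional part -/

/-- The least `N ≥ 0` such that `p ^ N * x` is a `p`-adic integer. -/
def padicPole (p : ℕ) [Fact p.Prime] (x : ℚ_[p]) : ℕ := (-x.valuation).toNat

theorem norm_padicPole_mul_le (p : ℕ) [hp : Fact p.Prime] (x : ℚ_[p]) :
    ‖(p : ℚ_[p]) ^ padicPole p x * x‖ ≤ 1 := by
  rcases eq_or_ne x 0 with rfl | hx
  · simp
  have hp0 : (p : ℚ_[p]) ≠ 0 := by exact_mod_cast hp.out.ne_zero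
  rw [Padic.norm_le_one_iff_val_nonneg, Padic.valuation_mul (pow_ne_zero _ hp0) hx,
    Padic.valuation_pow, Padic.valuation_p, padicPole]
  omega

/-- The `p`-adic fractional part `{x}_p`: if `x = ∑_{i ≥ -N} b_i p^i` with digits
`0 ≤ b_i < p`, this is the rational number `∑_{-N ≤ i < 0} b_i p^i`.  Indeed `p ^ N * x` has the
digit expansion `∑_{i ≥ 0} b_{i-N} p^i`, and `PadicInt.appr y N` is the sum of the first `N` terms
of the digit expansion of `y`, i.e. the only natural number below `p ^ N` congruent to `y`
modulo `p ^ N`. -/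
def padicFract (p : ℕ) [Fact p.Prime] (x : ℚ_[p]) : ℚ :=
  (PadicInt.appr ⟨(p : ℚ_[p]) ^ padicPole p x * x, norm_padicPole_mul_le p x⟩ (padicPole p x) : ℚ)
    / (p : ℚ) ^ padicPole p x

theorem padicFract_nonneg (p : ℕ) [Fact p.Prime] (x : ℚ_[p]) : 0 ≤ padicFract p x := by
  unfold padicFract; positivity

theorem padicFract_lt_one (p : ℕ) [hp : Fact p.Prime] (x : ℚ_[p]) : padicFract p x < 1 := by
  have hp0 : (0 : ℚ) < p := by exact_mod_cast hp.out.pos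
  unfold padicFract
  rw [div_lt_one (by positivity)]
  exact_mod_cast PadicInt.appr_lt _ _

theorem norm_sub_padicFract_le (p : ℕ) [hp : Fact p.Prime] (x : ℚ_[p]) :
    ‖x - (padicFract p x : ℚ_[p])‖ ≤ 1 := by
  have hp0 : (p : ℚ_[p]) ≠ 0 := by exact_mod_cast hp.out.ne_zero
  obtain ⟨c, hc⟩ := Ideal.mem_span_singleton'.mp (PadicInt.appr_spec (padicPole p x)
    ⟨(p : ℚ_[p]) ^ padicPole p x * x, norm_padicPole_mul_le p x⟩)
  have hc' : (c : ℚ_[p]) * (p : ℚ_[p]) ^ padicPole p x = (p : ℚ_[p]) ^ padicPole p x * x -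
      (PadicInt.appr ⟨(p : ℚ_[p]) ^ padicPole p x * x, norm_padicPole_mul_le p x⟩
        (padicPole p x) : ℚ_[p]) := by
    have h := congrArg (fun z : ℤ_[p] => (z : ℚ_[p])) hc
    have h2 (y : ℤ_[p]) (n : ℕ) : ((y - n : ℤ_[p]) : ℚ_[p]) = (y : ℚ_[p]) - (n : ℚ_[p]) := by simp
    simpa only [PadicInt.coe_mul, PadicInt.coe_pow, PadicInt.coe_natCast] using h.trans (h2 _ _)
  have : x - (padicFract p x : ℚ_[p]) = c := by
    have hpN : (p : ℚ_[p]) ^ padicPole p x ≠ 0 := pow_ne_zero _ hp0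
    unfold padicFract
    push_cast
    generalize (PadicInt.appr ⟨(p : ℚ_[p]) ^ padicPole p x * x, norm_padicPole_mul_le p x⟩
        (padicPole p x) : ℚ_[p]) = a at hc' ⊢
    field_simp
    linear_combination -hc'
  rw [this]
  exact c.2

theorem padicFract_eq_zero (p : ℕ) [Fact p.Prime] {x : ℚ_[p]} (hx : ‖x‖ ≤ 1) :
    padicFract p x = 0 := by
  have h0 : padicPole p x = 0 := by
    have := (Padic.norm_le_one_iff_val_nonneg x).mp hx
    unfold padicPole; omega
  unfold padicFract
  have := PadicInt.appr_lt ⟨(p : ℚ_[p]) ^ padicPole p x * x, norm_padicPole_mul_le p x⟩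
    (padicPole p x)
  rw [show p ^ padicPole p x = 1 by rw [h0, pow_zero], Nat.lt_one_iff] at this
  rw [this]; simp

/-! ### The adele ring `𝔸_Q`, the group `Γ_Q` and the solenoid `X_Q` -/

instance factPrime {Q : Set Nat.Primes} (p : Q) : Fact (Nat.Prime (p : Nat.Primes)) := ⟨p.1.2⟩

instance factIsOpen (Q : Set Nat.Primes) :
    Fact (∀ p : Q, IsOpen (PadicInt.subring (p : Nat.Primes) : Set ℚ_[(p : Nat.Primes)])) :=
  ⟨fun p => by
    have : (PadicInt.subring (p : Nat.Primes) : Set ℚ_[(p : Nat.Primes)])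
        = Metric.closedBall 0 1 := by
      ext x; simp [PadicInt.mem_subring_iff]
    rw [this]
    exact IsUltrametricDist.isOpen_closedBall 0 one_ne_zero⟩

/-- `𝔸_Q`: the product of `ℝ` and the restricted product of the `ℚ_p`, `p ∈ Q`, with respect to
the rings `ℤ_p`, with its ring structure and its restricted product topology. -/
abbrev Adele (Q : Set Nat.Primes) : Type :=
  ℝ × Πʳ p : Q, [ℚ_[(p : Nat.Primes)], (PadicInt.subring (p : Nat.Primes))]

/-- `Γ_Q = ℤ[1/p : p ∈ Q]`, a subring of `ℚ`. -/
def Gam (Q : Set Nat.Primes) : Subring ℚ :=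
  Subring.closure {x : ℚ | ∃ p ∈ Q, x = 1 / ((p : ℕ) : ℚ)}

theorem finite_not_integral (Q : Set Nat.Primes) (γ : ℚ) :
    {p : Q | ¬ (γ : ℚ_[(p : Nat.Primes)]) ∈ PadicInt.subring (p : Nat.Primes)}.Finite := by
  have hf : {n : ℕ | n ∣ γ.den}.Finite :=
    (Nat.divisors γ.den).finite_toSet.subset fun n hn => by simpa [γ.den_nz] using hn
  have hi : Function.Injective fun p : Q => ((p : Nat.Primes) : ℕ) := fun a b h =>
    Subtype.ext (Subtype.ext h)
  refine (hf.preimage hi.injOn).subset fun p hp => ?_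
  by_contra h
  exact hp ((PadicInt.mem_subring_iff _).mpr (Padic.norm_rat_le_one h))

/-- The diagonal embedding `γ ↦ (γ, γ, γ, …)` of `ℚ` into `𝔸_Q`. -/
def diag (Q : Set Nat.Primes) : ℚ →+* Adele Q where
  toFun γ := ((γ : ℝ), ⟨fun p => (γ : ℚ_[(p : Nat.Primes)]), finite_not_integral Q γ⟩)
  map_one' := by ext <;> simp
  map_mul' a b := Prod.ext (by simp) (RestrictedProduct.ext _ _ fun p => Rat.cast_mul a b)
  map_zero' := by ext <;> simp
  map_add' a b := Prod.ext (by simp) (RestrictedProduct.ext _ _ fun p => Rat.cast_add a b)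

/-- The image of `Γ_Q` in `𝔸_Q` under the diagonal embedding, as an additive subgroup. -/
def lattice (Q : Set Nat.Primes) : AddSubgroup (Adele Q) :=
  (Gam Q).toAddSubgroup.map (diag Q).toAddMonoidHom

/-- The solenoid `X_Q = 𝔸_Q / Γ_Q`, an additive topological group with the quotient topology. -/
def Solenoid (Q : Set Nat.Primes) : Type := Adele Q ⧸ lattice Q

instance (Q : Set Nat.Primes) : AddCommGroup (Solenoid Q) :=
  inferInstanceAs (AddCommGroup (Adele Q ⧸ lattice Q))

instance (Q : Set Nat.Primes) : TopologicalSpace (Solenoid Q) :=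
  inferInstanceAs (TopologicalSpace (Adele Q ⧸ lattice Q))

instance (Q : Set Nat.Primes) : IsTopologicalAddGroup (Solenoid Q) :=
  inferInstanceAs (IsTopologicalAddGroup (Adele Q ⧸ lattice Q))

/-- `X_Q` carries its Borel σ-algebra. -/
instance (Q : Set Nat.Primes) : MeasurableSpace (Solenoid Q) := borel _

instance (Q : Set Nat.Primes) : BorelSpace (Solenoid Q) := ⟨rfl⟩

/-- The canonical projection `𝔸_Q → X_Q`. -/
def proj (Q : Set Nat.Primes) : Adele Q →+ Solenoid Q := QuotientAddGroup.mk' (lattice Q)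

theorem continuous_proj (Q : Set Nat.Primes) : Continuous (proj Q) := continuous_quot_mk

theorem finite_padicFract_ne_zero (Q : Set Nat.Primes) (x : Adele Q) :
    {p : Q | padicFract (p : Nat.Primes) (x.2 p) ≠ 0}.Finite :=
  Set.Finite.subset x.2.2 fun _ hp h => hp (padicFract_eq_zero _ h)

theorem padicFract_mem_Gam (Q : Set Nat.Primes) (p : Q) (x : ℚ_[(p : Nat.Primes)]) :
    padicFract (p : Nat.Primes) x ∈ Gam Q := by
  have : (1 / (((p : Nat.Primes) : ℕ) : ℚ)) ∈ Gam Q :=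
    Subring.subset_closure ⟨p, p.2, rfl⟩
  unfold padicFract
  rw [div_eq_mul_one_div, ← one_div_pow]
  exact (Gam Q).mul_mem (natCast_mem _ _) ((Gam Q).pow_mem this _)

theorem norm_padicFract_le_of_ne (Q : Set Nat.Primes) {p q : Q} (hpq : p ≠ q)
    (x : ℚ_[(p : Nat.Primes)]) :
    ‖(padicFract (p : Nat.Primes) x : ℚ_[(q : Nat.Primes)])‖ ≤ 1 := by
  have hco : Nat.Coprime (q : Nat.Primes) (p : Nat.Primes) :=
    (Nat.coprime_primes q.1.2 p.1.2).mpr fun h => hpq (Subtype.ext (Subtype.ext h.symm))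
  unfold padicFract
  push_cast
  rw [norm_div, norm_pow, (Padic.norm_natCast_eq_one_iff).mpr hco, one_pow, div_one]
  exact_mod_cast Padic.norm_int_le_one _

/-- Every adele is congruent modulo `Γ_Q` to a point of `[0,1] × ∏ ℤ_p`. -/
theorem exists_reduced (Q : Set Nat.Primes) (x : Adele Q) :
    ∃ γ ∈ Gam Q, (x - diag Q γ).1 ∈ Set.Icc (0 : ℝ) 1 ∧
      ∀ p : Q, (x - diag Q γ).2 p ∈ PadicInt.subring (p : Nat.Primes) := by
  classical
  let s := (finite_padicFract_ne_zero Q x).toFinset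
  let γ₀ : ℚ := ∑ p ∈ s, padicFract (p : Nat.Primes) (x.2 p)
  have hγ₀ : γ₀ ∈ Gam Q := sum_mem fun p _ => padicFract_mem_Gam Q p _
  refine ⟨γ₀ + (⌊x.1 - γ₀⌋ : ℤ), add_mem hγ₀ (intCast_mem _ _), ?_, fun q => ?_⟩
  · have h1 := Int.floor_le (x.1 - (γ₀ : ℝ))
    have h2 := Int.lt_floor_add_one (x.1 - (γ₀ : ℝ))
    simp only [Prod.fst_sub, diag, RingHom.coe_mk, MonoidHom.coe_mk, OneHom.coe_mk, Set.mem_Icc]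
    push_cast
    constructor <;> linarith
  · change x.2 q - ((γ₀ + (⌊x.1 - γ₀⌋ : ℤ) : ℚ) : ℚ_[(q : Nat.Primes)]) ∈ _
    rw [Rat.cast_add, ← sub_sub, Rat.cast_intCast]
    refine sub_mem ?_ (intCast_mem _ _)
    have hsum : γ₀ = padicFract (q : Nat.Primes) (x.2 q)
        + ∑ p ∈ s.erase q, padicFract (p : Nat.Primes) (x.2 p) := by
      by_cases hq : q ∈ s
      · exact (Finset.add_sum_erase s (fun p : Q => padicFract (p : Nat.Primes) (x.2 p)) hq).symm
      · have h0 : padicFract (q : Nat.Primes) (x.2 q) = 0 := by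
          by_contra h; exact hq (by simpa [s] using h)
        rw [Finset.erase_eq_of_notMem hq, h0, zero_add]
    rw [hsum, Rat.cast_add, ← sub_sub]
    refine sub_mem ((PadicInt.mem_subring_iff _).mpr (norm_sub_padicFract_le _ _)) ?_
    rw [Rat.cast_sum]
    exact sum_mem fun p hp => (PadicInt.mem_subring_iff _).mpr
      (norm_padicFract_le_of_ne Q (Finset.ne_of_mem_erase hp) _)

instance compactSpace_solenoid (Q : Set Nat.Primes) : CompactSpace (Solenoid Q) := by
  have (p : Q) : CompactSpace (PadicInt.subring (p : Nat.Primes)) :=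
    inferInstanceAs (CompactSpace ℤ_[(p : Nat.Primes)])
  let f : Set.Icc (0 : ℝ) 1 × (∀ p : Q, PadicInt.subring (p : Nat.Primes)) → Solenoid Q :=
    fun z => proj Q ((z.1 : ℝ), structureMap _ _ _ z.2)
  have hf : Continuous f := (continuous_proj Q).comp
    ((continuous_subtype_val.comp continuous_fst).prodMk
      (isEmbedding_structureMap.continuous.comp continuous_snd))
  have hs : Function.Surjective f := by
    intro y
    obtain ⟨x, rfl⟩ := QuotientAddGroup.mk'_surjective (lattice Q) y
    obtain ⟨γ, hγ, h1, h2⟩ := exists_reduced Q x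
    refine ⟨(⟨_, h1⟩, fun p => ⟨_, h2 p⟩), ?_⟩
    refine (QuotientAddGroup.eq (s := lattice Q)).mpr ⟨γ, hγ, ?_⟩
    change diag Q γ = -(x - diag Q γ) + x
    abel
  exact hs.compactSpace hf

/-- The Haar probability measure on the compact group `X_Q`: the Haar measure normalised so that
the whole space has measure `1`. -/
def haar (Q : Set Nat.Primes) : Measure (Solenoid Q) := Measure.addHaarMeasure ⊤

instance (Q : Set Nat.Primes) : (haar Q).IsAddHaarMeasure :=
  inferInstanceAs
    (Measure.addHaarMeasure (⊤ : TopologicalSpace.PositiveCompacts (Solenoid Q))).IsAddHaarMeasure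

instance (Q : Set Nat.Primes) : IsProbabilityMeasure (haar Q) :=
  ⟨Measure.addHaarMeasure_self (K₀ := (⊤ : TopologicalSpace.PositiveCompacts (Solenoid Q)))⟩

/-! ### Bounded remainder sets -/

section BRS

variable {G : Type*} [AddCommGroup G] [MeasurableSpace G]

/-- The characteristic function of the multiset given by the finite family of sets
`A 0, …, A (k - 1)`, that is, the sum of their indicator functions. -/
def multiIndicator {k : ℕ} (A : Fin k → Set G) (x : G) : ℝ :=
  ∑ i, (A i).indicator (fun _ => (1 : ℝ)) x

/-- The volume of a multiset: the sum of the measures of the sets it is made of. -/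
def multiVolume (μ : Measure G) {k : ℕ} (A : Fin k → Set G) : ℝ := ∑ i, μ.real (A i)

/-- The multiset `A` (a finite family of measurable sets) is a bounded remainder set for the
rotation `x ↦ x + α`: there is `C > 0` such that for almost every `x` and all `N`,
`|∑_{n < N} χ_A (x + n α) - N |A|| ≤ C`. -/
def IsBRS (μ : Measure G) (α : G) {k : ℕ} (A : Fin k → Set G) : Prop :=
  (∀ i, MeasurableSet (A i)) ∧
    ∃ C : ℝ, 0 < C ∧ ∀ᵐ x ∂μ, ∀ N : ℕ,
      |∑ n ∈ Finset.range N, multiIndicator A (x + n • α) - N * multiVolume μ A| ≤ C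

/-- The set of all volumes of bounded remainder sets (multisets allowed) for `x ↦ x + α`. -/
def brsVolumes (μ : Measure G) (α : G) : Set ℝ :=
  {v | ∃ (k : ℕ) (A : Fin k → Set G), IsBRS μ α A ∧ v = multiVolume μ A}

end BRS

end AdelicBRS

end

noncomputable section

namespace AdelicBRS

/-! ### Integrality in `Γ_Q` -/

/-! The characters `angle γ` of `X_Q` are indexed by `γ ∈ Γ_Q`, and the numbers in the theorem are
exactly the real lifts of the values `angle γ α ∈ ℝ/ℤ`. So the claim is that `v ≥ 0` is a volume if
and only if `v` mod 1 is a character value at `α`. Necessity (`exists_angle_eq_of_isBRS`): bounded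
Birkhoff sums make `χ_A - v` a coboundary, with transfer function `g`. As `χ_A` is integer valued,
`exp(2πig)` is an eigenfunction of the rotation with eigenvalue `exp(2πiv)`. The characters separate
points, so by Stone–Weierstrass they span a dense subspace of `L²`, and every eigenvalue is a
character value at `α` (`exists_character_eq_eigenvalue`). Sufficiency
(`mem_brsVolumes_of_character`): let `g` be the lift of `angle γ` to `[0,1)`. Then `v + g(x) -
g(x+α)` takes values in `ℕ`, is bounded, has mean `v` and telescoping Birkhoff sums; its superlevel
sets form the multiset. -/

theorem norm_le_one_of_mem_Gam {Q : Set Nat.Primes} {r : ℚ} (hr : r ∈ Gam Q) (q : Nat.Primes)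
    [Fact (Nat.Prime q)] (hq : q ∉ Q) : ‖(r : ℚ_[q])‖ ≤ 1 := by
  have h : Gam Q ≤ (PadicInt.subring q).comap (Rat.castHom ℚ_[q]) := by
    refine Subring.closure_le.mpr ?_
    rintro _ ⟨p, hp, rfl⟩
    have hco : Nat.Coprime q p :=
      (Nat.coprime_primes q.2 p.2).mpr fun h => hq (by rwa [Subtype.ext h])
    simp [PadicInt.mem_subring_iff, Padic.norm_natCast_eq_one_iff.mpr hco]
  exact h hr

/-- If `p` divided the denominator, the numerator would be a `p`-adic unit and the denominator would
have norm below 1, forcing `‖r‖ > 1`. -/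
theorem not_dvd_den_of_norm_le_one {p : ℕ} [hp : Fact p.Prime] {r : ℚ} (h : ‖(r : ℚ_[p])‖ ≤ 1) :
    ¬ p ∣ r.den := by
  intro hd
  have hnum : ¬ p ∣ r.num.natAbs := fun hn =>
    hp.out.one_lt.ne' (Nat.dvd_one.mp (r.reduced.gcd_eq_one ▸ Nat.dvd_gcd hn hd))
  have hn1 : ‖((r.num : ℤ) : ℚ_[p])‖ = 1 := by
    refine le_antisymm (Padic.norm_int_le_one _) (not_lt.mp fun hlt => hnum ?_)
    exact Int.natCast_dvd.mp ((Padic.norm_intCast_lt_one_iff).mp hlt)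
  have hd1 : ‖((r.den : ℕ) : ℚ_[p])‖ < 1 := by
    exact_mod_cast Padic.norm_intCast_lt_one_iff.mpr (Int.natCast_dvd_natCast.mpr hd)
  have hmul : (r : ℚ_[p]) * (r.den : ℚ_[p]) = (r.num : ℚ_[p]) := by
    exact_mod_cast congrArg (Rat.cast : ℚ → ℚ_[p]) (Rat.mul_den_eq_num r)
  have := congrArg norm hmul
  rw [norm_mul, hn1] at this
  nlinarith [norm_nonneg (r : ℚ_[p]), norm_nonneg ((r.den : ℕ) : ℚ_[p])]

/-- An element of `Γ_Q` that is a `p`-adic integer for all `p ∈ Q` is an integer. -/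
theorem exists_int_of_norm_le_one {Q : Set Nat.Primes} {r : ℚ} (hr : r ∈ Gam Q)
    (h : ∀ p : Q, ‖(r : ℚ_[(p : Nat.Primes)])‖ ≤ 1) : ∃ n : ℤ, r = n := by
  refine ⟨r.num, ((Rat.den_eq_one_iff r).mp ?_).symm⟩
  by_contra hden
  obtain ⟨p, hp, hpd⟩ := Nat.exists_prime_and_dvd hden
  have : Fact p.Prime := ⟨hp⟩
  by_cases hQ : (⟨p, hp⟩ : Nat.Primes) ∈ Q
  · exact not_dvd_den_of_norm_le_one (h ⟨⟨p, hp⟩, hQ⟩) hpd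
  · exact not_dvd_den_of_norm_le_one (p := p) (norm_le_one_of_mem_Gam hr ⟨p, hp⟩ hQ) hpd

/-! ### The sum of the fractional parts of an adele -/

/-- The sum `∑_{p ∈ Q} {x_p}_p` of the fractional parts of the components of an adele. -/
def fractSum {Q : Set Nat.Primes} (x : Adele Q) : ℚ :=
  ∑ᶠ p : Q, padicFract (p : Nat.Primes) (x.2 p)

theorem fractSum_mem_Gam {Q : Set Nat.Primes} (x : Adele Q) : fractSum x ∈ Gam Q := by
  rw [fractSum, finsum_eq_sum _ (finite_padicFract_ne_zero Q x)]
  exact sum_mem fun p _ => padicFract_mem_Gam Q p _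

/-- The fractional parts at primes other than `q` are `q`-adic integers, so only `{x_q}_q` matters
at `q`. -/
theorem norm_sub_fractSum_le {Q : Set Nat.Primes} (x : Adele Q) (q : Q) :
    ‖x.2 q - (fractSum x : ℚ_[(q : Nat.Primes)])‖ ≤ 1 := by
  classical
  have hs : fractSum x = padicFract (q : Nat.Primes) (x.2 q)
      + ∑ p ∈ (finite_padicFract_ne_zero Q x).toFinset.erase q,
          padicFract (p : Nat.Primes) (x.2 p) := by
    rw [fractSum, finsum_eq_sum _ (finite_padicFract_ne_zero Q x)]
    by_cases hq : q ∈ (finite_padicFract_ne_zero Q x).toFinset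
    · exact (Finset.add_sum_erase _ (fun p : Q => padicFract (p : Nat.Primes) (x.2 p)) hq).symm
    · have h0 : padicFract (q : Nat.Primes) (x.2 q) = 0 := by
        by_contra h; exact hq (by simpa using h)
      rw [Finset.erase_eq_of_notMem hq, h0, zero_add]
      rfl
  rw [← PadicInt.mem_subring_iff, hs, Rat.cast_add, ← sub_sub, Rat.cast_sum]
  exact sub_mem ((PadicInt.mem_subring_iff _).mpr (norm_sub_padicFract_le _ _))
    (sum_mem fun p hp => (PadicInt.mem_subring_iff _).mpr
      (norm_padicFract_le_of_ne Q (Finset.ne_of_mem_erase hp) _))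

theorem fractSum_eq_zero {Q : Set Nat.Primes} {x : Adele Q}
    (hx : ∀ p : Q, x.2 p ∈ PadicInt.subring (p : Nat.Primes)) : fractSum x = 0 :=
  finsum_eq_zero_of_forall_eq_zero fun p =>
    padicFract_eq_zero _ ((PadicInt.mem_subring_iff _).mp (hx p))

/-- A rational in `Γ_Q` that agrees with an adele up to `p`-adic integers agrees with the sum of
its fractional parts up to an integer. -/
theorem exists_int_fractSum {Q : Set Nat.Primes} (x : Adele Q) {r : ℚ} (hr : r ∈ Gam Q)
    (h : ∀ p : Q, x.2 p - (r : ℚ_[(p : Nat.Primes)]) ∈ PadicInt.subring (p : Nat.Primes)) :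
    ∃ n : ℤ, fractSum x = r + n := by
  obtain ⟨n, hn⟩ := exists_int_of_norm_le_one (sub_mem (fractSum_mem_Gam x) hr) fun p => by
    have := sub_mem (h p) ((PadicInt.mem_subring_iff _).mpr (norm_sub_fractSum_le x p))
    rw [sub_sub_sub_cancel_left] at this
    rw [Rat.cast_sub]
    exact (PadicInt.mem_subring_iff _).mp this
  exact ⟨n, by rw [← hn]; ring⟩

theorem fractSum_add {Q : Set Nat.Primes} (x y : Adele Q) :
    ∃ n : ℤ, fractSum (x + y) = fractSum x + fractSum y + n := by
  refine exists_int_fractSum _ (add_mem (fractSum_mem_Gam x) (fractSum_mem_Gam y)) fun p => ?_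
  rw [Rat.cast_add]
  change x.2 p + y.2 p - _ ∈ _
  rw [add_sub_add_comm]
  exact add_mem ((PadicInt.mem_subring_iff _).mpr (norm_sub_fractSum_le x p))
    ((PadicInt.mem_subring_iff _).mpr (norm_sub_fractSum_le y p))

/-- Partial fraction decomposition of `r`. It makes the real and `p`-adic contributions to
`adeleAngle` cancel modulo 1 on the lattice. -/
theorem fractSum_diag {Q : Set Nat.Primes} {r : ℚ} (hr : r ∈ Gam Q) :
    ∃ n : ℤ, fractSum (diag Q r) = r + n := by
  refine exists_int_fractSum _ hr fun p => ?_
  change (r : ℚ_[(p : Nat.Primes)]) - _ ∈ _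
  rw [sub_self]
  exact zero_mem _

/-! ### The characters of the solenoid -/

theorem coe_eq_of_eq_add_int {a b : ℝ} (n : ℤ) (h : a = b + n) :
    (a : AddCircle (1 : ℝ)) = b := by
  rw [h, AddCircle.coe_add]
  simp

/-- The standard character `x ↦ -x_∞ + ∑ {x_p}_p` of the adeles, with values in `ℝ / ℤ`. -/
def adeleAngle (Q : Set Nat.Primes) : Adele Q →+ AddCircle (1 : ℝ) :=
  AddMonoidHom.mk' (fun x => ((-x.1 + (fractSum x : ℝ) : ℝ) : AddCircle (1 : ℝ))) fun x y => by
    obtain ⟨n, hn⟩ := fractSum_add x y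
    rw [← AddCircle.coe_add]
    refine coe_eq_of_eq_add_int n ?_
    rw [hn, Prod.fst_add]
    push_cast
    ring

theorem adeleAngle_apply {Q : Set Nat.Primes} (x : Adele Q) :
    adeleAngle Q x = ((-x.1 + (fractSum x : ℝ) : ℝ) : AddCircle (1 : ℝ)) := rfl

theorem adeleAngle_of_integral {Q : Set Nat.Primes} {x : Adele Q}
    (hx : ∀ p : Q, x.2 p ∈ PadicInt.subring (p : Nat.Primes)) :
    adeleAngle Q x = ((-x.1 : ℝ) : AddCircle (1 : ℝ)) := by
  rw [adeleAngle_apply, fractSum_eq_zero hx, Rat.cast_zero, add_zero]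

theorem adeleAngle_diag {Q : Set Nat.Primes} {r : ℚ} (hr : r ∈ Gam Q) :
    adeleAngle Q (diag Q r) = 0 := by
  obtain ⟨n, hn⟩ := fractSum_diag hr
  rw [adeleAngle_apply, hn, ← AddCircle.coe_zero]
  refine coe_eq_of_eq_add_int n ?_
  change -(r : ℝ) + _ = _
  push_cast
  ring

/-- For a homomorphism, continuity at 0 is enough, and on the open subgroup of adeles with integral
components only the real coordinate contributes. -/
theorem continuous_adeleAngle (Q : Set Nat.Primes) : Continuous (adeleAngle Q) := by
  refine continuous_of_continuousAt_zero (adeleAngle Q) ?_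
  have hU : IsOpen {x : Adele Q | ∀ p : Q, x.2 p ∈ PadicInt.subring (p : Nat.Primes)} :=
    (isOpen_forall_mem (factIsOpen Q).out).preimage continuous_snd
  have hf : Continuous fun x : Adele Q => ((-x.1 : ℝ) : AddCircle (1 : ℝ)) :=
    (AddCircle.continuous_mk' 1).comp continuous_fst.neg
  refine hf.continuousAt.congr ?_
  filter_upwards [hU.mem_nhds (x := 0) fun p => zero_mem _] with x hx
  exact (adeleAngle_of_integral hx).symm

/-- The character `x ↦ -γ x_∞ + ∑ {γ x_p}_p` of the solenoid, with values in `ℝ / ℤ`. -/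
def angle {Q : Set Nat.Primes} (γ : Gam Q) : Solenoid Q →+ AddCircle (1 : ℝ) :=
  QuotientAddGroup.lift (lattice Q)
    ((adeleAngle Q).comp (AddMonoidHom.mulLeft (diag Q (γ : ℚ)))) <| by
      rintro _ ⟨r, hr, rfl⟩
      change adeleAngle Q (diag Q γ * diag Q r) = 0
      rw [← map_mul]
      exact adeleAngle_diag ((Gam Q).mul_mem γ.2 hr)

theorem angle_proj {Q : Set Nat.Primes} (γ : Gam Q) (x : Adele Q) :
    angle γ (proj Q x) = adeleAngle Q (diag Q γ * x) := rfl

theorem proj_surjective (Q : Set Nat.Primes) : Function.Surjective (proj Q) :=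
  QuotientAddGroup.mk'_surjective (lattice Q)

theorem continuous_angle {Q : Set Nat.Primes} (γ : Gam Q) : Continuous (angle γ) := by
  have h : Continuous fun x : Adele Q => adeleAngle Q (diag Q γ * x) :=
    (continuous_adeleAngle Q).comp (continuous_const.mul continuous_id)
  exact continuous_quot_lift _ h

theorem angle_zero (Q : Set Nat.Primes) : angle (0 : Gam Q) = 0 := by
  ext x
  obtain ⟨x, rfl⟩ := proj_surjective Q x
  simp [angle_proj]

theorem angle_add {Q : Set Nat.Primes} (γ δ : Gam Q) (x : Solenoid Q) :
    angle (γ + δ) x = angle γ x + angle δ x := by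
  obtain ⟨x, rfl⟩ := proj_surjective Q x
  simp only [angle_proj, Subring.coe_add, map_add, add_mul]

theorem angle_neg {Q : Set Nat.Primes} (γ : Gam Q) (x : Solenoid Q) :
    angle (-γ) x = -angle γ x := by
  refine eq_neg_of_add_eq_zero_left ?_
  rw [← angle_add, neg_add_cancel, angle_zero, AddMonoidHom.zero_apply]

theorem angle_proj_eq {Q : Set Nat.Primes} (γ : Gam Q) (x : Adele Q) :
    angle γ (proj Q x) = ((-((γ : ℚ) * x.1) + ∑ᶠ p : Q, (padicFract (p : Nat.Primes)
      (((γ : ℚ) : ℚ_[(p : Nat.Primes)]) * x.2 p) : ℝ) : ℝ) : AddCircle (1 : ℝ)) := by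
  rw [angle_proj, adeleAngle_apply, fractSum]
  congr 2
  exact (Rat.castHom ℝ).toAddMonoidHom.map_finsum (finite_padicFract_ne_zero Q (diag Q γ * x))

/-! ### Characters separate points -/

theorem proj_eq_zero_iff {Q : Set Nat.Primes} (x : Adele Q) :
    proj Q x = 0 ↔ ∃ r ∈ Gam Q, diag Q r = x :=
  QuotientAddGroup.eq_zero_iff (N := lattice Q) x

/-- A `p`-adic integer whose quotients by all powers of `p` have an integral fractional part
vanishes. -/
theorem eq_zero_of_padicFract_div_pow (p : ℕ) [hp : Fact p.Prime] (x : ℚ_[p])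
    (h : ∀ k : ℕ, padicFract p ((p : ℚ_[p])⁻¹ ^ k * x) = 0) : x = 0 := by
  have hp1 : (1 : ℝ) < p := by exact_mod_cast hp.out.one_lt
  rw [← norm_le_zero_iff]
  have hb : ∀ k : ℕ, ‖x‖ ≤ ((p : ℝ)⁻¹) ^ k := fun k => by
    have := norm_sub_padicFract_le p ((p : ℚ_[p])⁻¹ ^ k * x)
    rw [h k, Rat.cast_zero, sub_zero, norm_mul, norm_pow, norm_inv, Padic.norm_p, inv_inv] at this
    rw [inv_pow, ← one_div, le_div_iff₀ (by positivity)]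
    linarith
  exact ge_of_tendsto' (tendsto_pow_atTop_nhds_zero_of_lt_one (by positivity)
    (inv_lt_one_of_one_lt₀ hp1)) hb

/-- Modulo the lattice, all `p`-adic components are integral. The character of `1` then forces the
real coordinate to be an integer, which is subtracted; the characters of `p⁻ᵏ` show that the
component at `p` is divisible by every power of `p`. -/
theorem eq_zero_of_angle_eq_zero {Q : Set Nat.Primes} {y : Solenoid Q}
    (h : ∀ γ : Gam Q, angle γ y = 0) : y = 0 := by
  obtain ⟨x, rfl⟩ := proj_surjective Q y
  obtain ⟨r, hr, -, hint⟩ := exists_reduced Q x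
  have hxr : proj Q (x - diag Q r) = proj Q x := by
    rw [map_sub, (proj_eq_zero_iff _).mpr ⟨r, hr, rfl⟩, sub_zero]
  rw [← hxr] at h ⊢
  generalize x - diag Q r = z at h hint ⊢
  obtain ⟨n, hn⟩ : ∃ n : ℤ, z.1 = n := by
    have h1 := h 1
    rw [angle_proj, Subring.coe_one, map_one, one_mul, adeleAngle_of_integral hint,
      AddCircle.coe_eq_zero_iff] at h1
    obtain ⟨m, hm⟩ := h1
    exact ⟨-m, by push_cast; simp at hm; linarith⟩
  have hzn : proj Q (z - diag Q n) = proj Q z := by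
    rw [map_sub, (proj_eq_zero_iff _).mpr ⟨n, intCast_mem _ _, rfl⟩, sub_zero]
  rw [← hzn] at h ⊢
  have hw1 : (z - diag Q n).1 = 0 := by
    change z.1 - ((n : ℚ) : ℝ) = 0
    rw [hn]; simp
  have hw2 : ∀ p : Q, (z - diag Q n).2 p ∈ PadicInt.subring (p : Nat.Primes) := fun p => by
    change z.2 p - ((n : ℚ) : ℚ_[(p : Nat.Primes)]) ∈ _
    rw [Rat.cast_intCast]
    exact sub_mem (hint p) (intCast_mem _ _)
  generalize z - diag Q n = w at h hw1 hw2 ⊢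
  have hw : w = 0 := by
    refine Prod.ext hw1 (RestrictedProduct.ext _ _ fun p => ?_)
    refine eq_zero_of_padicFract_div_pow _ _ fun k => ?_
    have hγ : (((p : Nat.Primes) : ℕ) : ℚ)⁻¹ ^ k ∈ Gam Q :=
      (Gam Q).pow_mem (Subring.subset_closure ⟨p, p.2, by simp⟩) k
    have hk := h ⟨_, hγ⟩
    rw [angle_proj_eq, hw1, finsum_eq_single _ p] at hk
    · rw [mul_zero, neg_zero, zero_add, AddCircle.coe_eq_zero_iff] at hk
      obtain ⟨m, hm⟩ := hk
      simp only [zsmul_eq_mul, mul_one, Rat.cast_pow, Rat.cast_inv, Rat.cast_natCast] at hm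
      have h0 := padicFract_nonneg (p : Nat.Primes)
        ((((p : Nat.Primes) : ℕ) : ℚ_[(p : Nat.Primes)])⁻¹ ^ k * w.2 p)
      have h1 := padicFract_lt_one (p : Nat.Primes)
        ((((p : Nat.Primes) : ℕ) : ℚ_[(p : Nat.Primes)])⁻¹ ^ k * w.2 p)
      have hm' : (m : ℚ) = padicFract (p : Nat.Primes)
        ((((p : Nat.Primes) : ℕ) : ℚ_[(p : Nat.Primes)])⁻¹ ^ k * w.2 p) := by exact_mod_cast hm
      -- The fractional part lies in `[0,1)` and is an integer.
      rw [← hm'] at h0 h1 ⊢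
      have : m = 0 := le_antisymm (Int.lt_add_one_iff.mp (by exact_mod_cast h1))
        (by exact_mod_cast h0)
      simp [this]
    -- At `q ≠ p` the number `p⁻ᵏ` is a unit, so the component stays integral.
    · intro q hq
      have hco : Nat.Coprime (q : Nat.Primes) (p : Nat.Primes) :=
        (Nat.coprime_primes q.1.2 p.1.2).mpr fun h => hq (Subtype.ext (Subtype.ext h))
      have hle : ‖w.2 q‖ ≤ 1 := (PadicInt.mem_subring_iff _).mp (hw2 q)
      rw [padicFract_eq_zero, Rat.cast_zero]
      push_cast
      rw [norm_mul, norm_pow, norm_inv, Padic.norm_natCast_eq_one_iff.mpr hco, inv_one, one_pow,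
        one_mul]
      exact hle
  rw [hw, map_zero]

/-- The characters inject `X_Q` continuously into a product of circles, so closedness of the lattice
need not be checked directly. -/
theorem t2Space_solenoid (Q : Set Nat.Primes) : T2Space (Solenoid Q) := by
  refine .of_injective_continuous (f := fun x (γ : Gam Q) => angle γ x) (fun x y hxy => ?_)
    (continuous_pi continuous_angle)
  refine sub_eq_zero.mp (eq_zero_of_angle_eq_zero fun γ => ?_)
  rw [map_sub, sub_eq_zero]
  exact congrFun hxy γ

/-! ### Density of the characters and eigenvalues of rotations -/

/-- The character of the solenoid attached to `γ`, as a continuous complex valued function. -/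
def character {Q : Set Nat.Primes} (γ : Gam Q) : C(Solenoid Q, ℂ) where
  toFun x := (angle γ x).toCircle
  continuous_toFun := continuous_induced_dom.comp
    (AddCircle.continuous_toCircle.comp (continuous_angle γ))

theorem character_apply {Q : Set Nat.Primes} (γ : Gam Q) (x : Solenoid Q) :
    character γ x = (angle γ x).toCircle := rfl

theorem character_add_index {Q : Set Nat.Primes} (γ δ : Gam Q) :
    character (γ + δ) = character γ * character δ := by
  ext x
  simp [character_apply, angle_add, AddCircle.toCircle_add]

theorem character_neg {Q : Set Nat.Primes} (γ : Gam Q) : character (-γ) = star (character γ) := by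
  ext x
  rw [character_apply, angle_neg, AddCircle.toCircle_neg, Circle.coe_inv_eq_conj]
  rfl

theorem character_add_apply {Q : Set Nat.Primes} (γ : Gam Q) (x y : Solenoid Q) :
    character γ (x + y) = character γ x * character γ y := by
  simp [character_apply, AddCircle.toCircle_add]

/-- The star subalgebra generated by the characters of the solenoid. -/
def characterSubalgebra (Q : Set Nat.Primes) : StarSubalgebra ℂ C(Solenoid Q, ℂ) where
  toSubalgebra := Algebra.adjoin ℂ (Set.range (character (Q := Q)))
  star_mem' := by
    change Algebra.adjoin ℂ (Set.range (character (Q := Q))) ≤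
      star (Algebra.adjoin ℂ (Set.range (character (Q := Q))))
    refine Algebra.adjoin_le ?_
    rintro - ⟨γ, rfl⟩
    exact Algebra.subset_adjoin ⟨-γ, character_neg γ⟩

/-- The characters, including the constant 1 at `γ = 0`, are closed under products, so the algebra
they generate is their linear span. -/
theorem characterSubalgebra_coe (Q : Set Nat.Primes) :
    Subalgebra.toSubmodule (characterSubalgebra Q).toSubalgebra =
      Submodule.span ℂ (Set.range (character (Q := Q))) := by
  refine Algebra.adjoin_eq_span_of_subset _ (Set.Subset.trans ?_ Submodule.subset_span)
  intro x hx
  refine Submonoid.closure_induction (fun _ => id) ⟨0, ?_⟩ ?_ hx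
  · ext x
    simp [character_apply, angle_zero]
  · rintro - - - - ⟨γ, rfl⟩ ⟨δ, rfl⟩
    exact ⟨γ + δ, character_add_index γ δ⟩

theorem span_character_closure_eq_top (Q : Set Nat.Primes) :
    (Submodule.span ℂ (Set.range (character (Q := Q)))).topologicalClosure = ⊤ := by
  rw [← characterSubalgebra_coe]
  refine congr_arg (Subalgebra.toSubmodule <| StarSubalgebra.toSubalgebra ·)
    (ContinuousMap.starSubalgebra_topologicalClosure_eq_top_of_separatesPoints
      (characterSubalgebra Q) fun x y hxy => ?_)
  obtain ⟨γ, hγ⟩ : ∃ γ : Gam Q, angle γ x ≠ angle γ y := by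
    by_contra! h
    refine hxy (sub_eq_zero.mp (eq_zero_of_angle_eq_zero fun γ => ?_))
    rw [map_sub, h, sub_self]
  refine ⟨_, ⟨character γ, Algebra.subset_adjoin ⟨γ, rfl⟩, rfl⟩, fun h => hγ ?_⟩
  exact AddCircle.injective_toCircle one_ne_zero (Subtype.coe_injective h)

instance (Q : Set Nat.Primes) : (haar Q).Regular :=
  have := t2Space_solenoid Q
  inferInstanceAs
    (Measure.addHaarMeasure (⊤ : TopologicalSpace.PositiveCompacts (Solenoid Q))).Regular

/-- A square integrable function orthogonal to all characters vanishes almost everywhere. -/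
theorem ae_eq_zero_of_integral_character_mul {Q : Set Nat.Primes} {h : Solenoid Q → ℂ}
    (hh : MemLp h 2 (haar Q)) (h0 : ∀ γ : Gam Q, ∫ x, character γ x * h x ∂haar Q = 0) :
    h =ᵐ[haar Q] 0 := by
  have := t2Space_solenoid Q
  let T : C(Solenoid Q, ℂ) →L[ℂ] Lp ℂ 2 (haar Q) := ContinuousMap.toLp 2 (haar Q) ℂ
  let K := Submodule.span ℂ (Set.range fun γ : Gam Q => T (character γ))
  have htop : K.topologicalClosure = ⊤ := by
    have := (ContinuousMap.toLp_denseRange ℂ (haar Q) ℂ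
      (by norm_num : (2 : ENNReal) ≠ ⊤)).topologicalClosure_map_submodule
        (span_character_closure_eq_top Q)
    rw [Submodule.map_span, ← Set.range_comp] at this
    exact this
  have hK : hh.toLp h ∈ Kᗮ := by
    rw [Submodule.mem_orthogonal]
    intro u hu
    induction hu using Submodule.span_induction with
    | mem u hu =>
      obtain ⟨γ, rfl⟩ := hu
      -- The inner product conjugates its first argument, which turns `γ` into `-γ`.
      rw [L2.inner_def, ← h0 (-γ)]
      refine integral_congr_ae ?_
      filter_upwards [hh.coeFn_toLp, ContinuousMap.coeFn_toLp (p := 2) (𝕜 := ℂ) (haar Q)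
        (character γ)] with x hx1 hx2
      rw [hx1, hx2, RCLike.inner_apply, character_neg, mul_comm]
      rfl
    | zero => exact inner_zero_left _
    | add u v _ _ hu hv => rw [inner_add_left, hu, hv, add_zero]
    | smul a u _ hu => rw [inner_smul_left, hu, mul_zero]
  rw [Submodule.topologicalClosure_eq_top_iff.mp htop, Submodule.mem_bot] at hK
  exact (hh.coeFn_toLp.symm.trans (by rw [hK])).trans (Lp.coeFn_zero ℂ 2 (haar Q))

/-- Every eigenvalue of a rotation of the solenoid is the value of a character. -/
theorem exists_character_eq_eigenvalue {Q : Set Nat.Primes} {h : Solenoid Q → ℂ}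
    (hh : MemLp h 2 (haar Q)) (hne : ¬ h =ᵐ[haar Q] 0) {α : Solenoid Q} {c : ℂ}
    (hc : ∀ᵐ x ∂haar Q, h (x + α) = c * h x) : ∃ γ : Gam Q, c = character γ α := by
  obtain ⟨γ, hγ⟩ : ∃ γ : Gam Q, ∫ x, character γ x * h x ∂haar Q ≠ 0 := by
    by_contra! H
    exact hne (ae_eq_zero_of_integral_character_mul hh H)
  refine ⟨-γ, ?_⟩
  -- By invariance of Haar measure, the nonzero coefficient is multiplied by `character γ α * c`,
  -- which must therefore be 1.
  have h1 := integral_add_right_eq_self (μ := haar Q) (fun x => character γ x * h x) α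
  have h2 : ∫ x, character γ (x + α) * h (x + α) ∂haar Q
      = (character γ α * c) * ∫ x, character γ x * h x ∂haar Q := by
    rw [← integral_const_mul]
    refine integral_congr_ae ?_
    filter_upwards [hc] with x hx
    rw [hx, character_add_apply]
    ring
  rw [h2] at h1
  have h3 : character γ α * c = 1 := mul_right_cancel₀ hγ (by rw [h1, one_mul])
  have h4 : character (-γ) α * character γ α = 1 := by
    rw [← ContinuousMap.mul_apply, ← character_add_index, neg_add_cancel]
    simp [character_apply, angle_zero]
  calc c = character (-γ) α * character γ α * c := by rw [h4, one_mul]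
    _ = character (-γ) α := by rw [mul_assoc, h3, mul_one]

/-! ### Bounded remainder sets and transfer functions -/

section Transfer

variable {G : Type*}

theorem measurable_multiIndicator [MeasurableSpace G] {k : ℕ} {A : Fin k → Set G}
    (hA : ∀ i, MeasurableSet (A i)) : Measurable (multiIndicator A) := by
  unfold multiIndicator
  exact Finset.measurable_sum _ fun i _ => measurable_const.indicator (hA i)

theorem exists_nat_multiIndicator {k : ℕ} (A : Fin k → Set G) (x : G) :
    ∃ m : ℕ, multiIndicator A x = m := by
  classical
  refine ⟨∑ i, if x ∈ A i then 1 else 0, ?_⟩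
  simp [multiIndicator, Set.indicator_apply]

theorem integral_multiIndicator [MeasurableSpace G] (μ : Measure G) [IsFiniteMeasure μ] {k : ℕ}
    {A : Fin k → Set G} (hA : ∀ i, MeasurableSet (A i)) :
    ∫ x, multiIndicator A x ∂μ = multiVolume μ A := by
  unfold multiIndicator multiVolume
  rw [integral_finsetSum _ fun i _ => (integrable_const 1).indicator (hA i)]
  exact Finset.sum_congr rfl fun i _ => by rw [integral_indicator_const _ (hA i)]; simp

/-- A bounded function with bounded Birkhoff sums is a coboundary: the upper limit of the Birkhoff
sums is a transfer function. -/
theorem limsup_birkhoff_add [AddCommGroup G] {f : G → ℝ} {α x : G} {C : ℝ}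
    (h : ∀ N : ℕ, |∑ n ∈ Finset.range N, f (x + n • α)| ≤ C) :
    Filter.limsup (fun N : ℕ => ∑ n ∈ Finset.range N, f (x + α + n • α)) Filter.atTop =
      Filter.limsup (fun N : ℕ => ∑ n ∈ Finset.range N, f (x + n • α)) Filter.atTop - f x := by
  have hs : (fun N : ℕ => ∑ n ∈ Finset.range N, f (x + α + n • α)) =
      fun N => (∑ n ∈ Finset.range (N + 1), f (x + n • α)) + -f x := by
    funext N
    rw [Finset.sum_range_succ']
    simp [add_assoc, succ_nsmul']
  rw [hs, ← Filter.limsup_nat_add (fun N : ℕ => ∑ n ∈ Finset.range N, f (x + n • α)) 1,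
    sub_eq_add_neg]
  -- A real `limsup` commutes with adding a constant only under boundedness, which the bound `C`
  -- supplies on both sides.
  refine limsup_add_const _ _ _ ?_ ?_
  · exact Filter.isBoundedUnder_of ⟨C, fun N => (abs_le.mp (h _)).2⟩
  · exact Filter.IsBoundedUnder.isCoboundedUnder_le
      (Filter.isBoundedUnder_of ⟨-C, fun N => (abs_le.mp (h _)).1⟩)

/-- A bounded measurable function with values in `ℕ` whose Birkhoff sums deviate boundedly from
the mean is the indicator of a bounded remainder multiset, given by its superlevel sets. -/
theorem integral_mem_brsVolumes [AddCommGroup G] [MeasurableSpace G] (μ : Measure G)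
    [IsFiniteMeasure μ] {α : G} {F : G → ℕ} (hF : Measurable F) {M : ℕ} (hM : ∀ x, F x ≤ M) {C : ℝ} (hC : 0 < C)
    (h : ∀ x, ∀ N : ℕ,
      |∑ n ∈ Finset.range N, (F (x + n • α) : ℝ) - N * ∫ y, (F y : ℝ) ∂μ| ≤ C) :
    ∫ y, (F y : ℝ) ∂μ ∈ brsVolumes μ α := by
  let A : Fin M → Set G := fun i => {x | (i : ℕ) < F x}
  have hA : ∀ i, MeasurableSet (A i) := fun i => measurableSet_lt measurable_const hF
  have hind : ∀ x, multiIndicator A x = F x := fun x => by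
    have h1 : multiIndicator A x = ∑ i ∈ Finset.range M, if i < F x then (1 : ℝ) else 0 := by
      rw [← Fin.sum_univ_eq_sum_range (fun i => if i < F x then (1 : ℝ) else 0)]
      simp [multiIndicator, Set.indicator_apply, A]
    have h2 : (Finset.range M).filter (· < F x) = Finset.range (F x) := by
      ext i
      have := hM x
      simp only [Finset.mem_filter, Finset.mem_range]
      omega
    rw [h1, Finset.sum_boole, h2, Finset.card_range]
  have hvol : multiVolume μ A = ∫ y, (F y : ℝ) ∂μ := by
    rw [← integral_multiIndicator μ hA]
    simp only [hind]
  refine ⟨M, A, ⟨hA, C, hC, Filter.Eventually.of_forall fun x N => ?_⟩, hvol.symm⟩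
  rw [hvol]
  simpa only [hind] using h x N

/-- A nonnegative lift of the value at `α` of a measurable character with values in `ℝ / ℤ` is the
volume of a bounded remainder set. -/
theorem mem_brsVolumes_of_character [AddCommGroup G] [MeasurableSpace G] [MeasurableAdd G]
    (μ : Measure G) [IsProbabilityMeasure μ] [μ.IsAddRightInvariant] {θ : G →+ AddCircle (1 : ℝ)}
    (hθ : Measurable θ) {α : G} {v : ℝ} (hv : 0 ≤ v) (hθα : θ α = (v : AddCircle (1 : ℝ))) :
    v ∈ brsVolumes μ α := by
  have : Fact ((0 : ℝ) < 1) := ⟨one_pos⟩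
  let g : G → ℝ := fun x => (AddCircle.measurableEquivIco (1 : ℝ) 0 (θ x) : ℝ)
  have hg : Measurable g :=
    measurable_subtype_coe.comp ((AddCircle.measurableEquivIco (1 : ℝ) 0).measurable.comp hθ)
  have hg0 : ∀ x, 0 ≤ g x := fun x => (AddCircle.measurableEquivIco (1 : ℝ) 0 (θ x)).2.1
  have hg1 : ∀ x, g x < 1 := fun x => by
    simpa using (AddCircle.measurableEquivIco (1 : ℝ) 0 (θ x)).2.2
  have hgθ : ∀ x, ((g x : ℝ) : AddCircle (1 : ℝ)) = θ x := fun x =>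
    (AddCircle.measurableEquivIco (1 : ℝ) 0).symm_apply_apply (θ x)
  have hgi : Integrable g μ := Integrable.of_bound hg.aestronglyMeasurable 1
    (Filter.Eventually.of_forall fun x => by
      rw [Real.norm_of_nonneg (hg0 x)]; exact (hg1 x).le)
  -- The expression is an integer since its class is `θ α + θ x - θ (x + α) = 0`. It exceeds `-1`
  -- because `v ≥ 0` and `g` lies in `[0,1)`, so it is nonnegative.
  have hint : ∀ x, ∃ m : ℕ, v + g x - g (x + α) = m := fun x => by
    have : ((v + g x - g (x + α) : ℝ) : AddCircle (1 : ℝ)) = 0 := by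
      rw [AddCircle.coe_sub, AddCircle.coe_add, hgθ, hgθ, map_add, hθα]
      abel
    obtain ⟨m, hm⟩ := (AddCircle.coe_eq_zero_iff _).mp this
    rw [zsmul_eq_mul, mul_one] at hm
    have hm0 : (-1 : ℝ) < m := by linarith [hg0 x, hg1 (x + α)]
    have hm1 : 0 ≤ m := by
      have : (-1 : ℤ) < m := by exact_mod_cast hm0
      omega
    lift m to ℕ using hm1
    exact ⟨m, by rw [← hm]; simp⟩
  have hfloor : ∀ x, ((⌊v + g x - g (x + α)⌋₊ : ℕ) : ℝ) = v + g x - g (x + α) := fun x => by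
    obtain ⟨m, hm⟩ := hint x
    rw [hm, Nat.floor_natCast]
  have hgα : Measurable fun x => g (x + α) := hg.comp (measurable_add_const α)
  have hvol : ∫ y, ((⌊v + g y - g (y + α)⌋₊ : ℕ) : ℝ) ∂μ = v := by
    simp only [hfloor]
    have h1 : Integrable (fun y => v + g y) μ := (integrable_const v).add hgi
    rw [integral_sub h1 (hgi.comp_add_right α), integral_add (integrable_const v) hgi,
      integral_add_right_eq_self]
    simp
  have hF : Measurable fun x => ⌊v + g x - g (x + α)⌋₊ :=
    ((measurable_const.add hg).sub hgα).nat_floor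
  -- The remainder bound 1 comes from telescoping: the deviation is `g x - g (x + N • α)`, a
  -- difference of two points of `[0,1)`.
  have key := integral_mem_brsVolumes μ (α := α) hF (M := ⌊v + 1⌋₊)
    (fun x => Nat.floor_mono (by linarith [hg0 (x + α), hg1 x])) one_pos fun x N => ?_
  · rwa [hvol] at key
  · rw [hvol]
    simp only [hfloor]
    have hsum : ∑ n ∈ Finset.range N, (v + g (x + n • α) - g (x + n • α + α)) =
        N * v + (g x - g (x + N • α)) := by
      induction N with
      | zero => simp
      | succ N ih =>
        rw [Finset.sum_range_succ, ih, succ_nsmul, ← add_assoc x]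
        push_cast
        ring
    rw [hsum, abs_le]
    constructor <;> linarith [hg0 x, hg1 x, hg0 (x + N • α), hg1 (x + N • α)]

end Transfer

/-- The volume of a bounded remainder set is congruent modulo `ℤ` to the value of a character. -/
theorem exists_angle_eq_of_isBRS {Q : Set Nat.Primes} {α : Solenoid Q} {k : ℕ}
    {A : Fin k → Set (Solenoid Q)} (hA : IsBRS (haar Q) α A) :
    ∃ γ : Gam Q, angle γ α = (multiVolume (haar Q) A : AddCircle (1 : ℝ)) := by
  obtain ⟨hmeas, C, -, hC⟩ := hA
  set v := multiVolume (haar Q) A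
  let f : Solenoid Q → ℝ := fun x => multiIndicator A x - v
  have hf : Measurable f := (measurable_multiIndicator hmeas).sub_const v
  -- Taking a `limsup` gives a measurable transfer function; the coboundary identity is needed only
  -- for almost every `x`.
  let g : Solenoid Q → ℝ := fun x =>
    Filter.limsup (fun N : ℕ => ∑ n ∈ Finset.range N, f (x + n • α)) Filter.atTop
  have hg : Measurable g := Measurable.limsup fun N =>
    Finset.measurable_sum _ fun n _ => hf.comp (measurable_add_const (n • α))
  let h : Solenoid Q → ℂ := fun x =>
    (AddCircle.toCircle ((g x : ℝ) : AddCircle (1 : ℝ)) : ℂ)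
  have hh : Measurable h := (continuous_induced_dom.comp
    (AddCircle.continuous_toCircle.comp (AddCircle.continuous_mk' 1))).measurable.comp hg
  have hnorm : ∀ x, ‖h x‖ = 1 := fun x => Circle.norm_coe _
  have hL2 : MemLp h 2 (haar Q) := MemLp.of_bound hh.aestronglyMeasurable 1
    (Filter.Eventually.of_forall fun x => (hnorm x).le)
  have hne : ¬ h =ᵐ[haar Q] 0 := fun H => by
    obtain ⟨x, hx⟩ := H.exists
    have := hnorm x
    rw [hx] at this
    simp at this
  obtain ⟨γ, hγ⟩ := exists_character_eq_eigenvalue hL2 hne (α := α)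
    (c := (AddCircle.toCircle (v : AddCircle (1 : ℝ)) : ℂ)) (by
      filter_upwards [hC] with x hx
      have hgx : g (x + α) = g x - f x := limsup_birkhoff_add (C := C) fun N => by
        simpa [f, Finset.sum_sub_distrib] using hx N
      obtain ⟨m, hm⟩ := exists_nat_multiIndicator A x
      -- Modulo 1 the integer `χ_A(x)` disappears and only the shift by `v` remains.
      have : ((g (x + α) : ℝ) : AddCircle (1 : ℝ)) = (v : AddCircle (1 : ℝ)) + g x := by
        rw [← AddCircle.coe_add]
        refine coe_eq_of_eq_add_int (-m) ?_
        simp only [hgx, f, hm]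
        push_cast
        ring
      simp only [h]
      rw [this, AddCircle.toCircle_add, Circle.coe_mul])
  exact ⟨γ, AddCircle.injective_toCircle one_ne_zero (Subtype.coe_injective hγ.symm)⟩

end AdelicBRS

end

/-! ### The set of volumes -/

theorem theorem1p2 (Q : Set Nat.Primes) (α : AdelicBRS.Adele Q) (hα : Irrational α.1) :
    AdelicBRS.brsVolumes (AdelicBRS.haar Q) (AdelicBRS.proj Q α) =
      {v : ℝ | 0 ≤ v ∧ ∃ γ ∈ AdelicBRS.Gam Q, ∃ n : ℤ,
        v = -((γ : ℝ) * α.1)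
          + ∑ᶠ p : Q, (AdelicBRS.padicFract (p : Nat.Primes)
              ((γ : ℚ_[(p : Nat.Primes)]) * α.2 p) : ℝ)
          + (n : ℝ)} := by
  ext v
  constructor
  · rintro ⟨k, A, hA, rfl⟩
    refine ⟨Finset.sum_nonneg fun i _ => measureReal_nonneg, ?_⟩
    obtain ⟨γ, hγ⟩ := AdelicBRS.exists_angle_eq_of_isBRS hA
    rw [AdelicBRS.angle_proj_eq, eq_comm, ← sub_eq_zero, ← AddCircle.coe_sub,
      AddCircle.coe_eq_zero_iff] at hγ
    obtain ⟨n, hn⟩ := hγ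
    rw [zsmul_eq_mul, mul_one] at hn
    exact ⟨γ, γ.2, n, by rw [hn]; ring⟩
  · rintro ⟨hv, γ, hγ, n, hn⟩
    refine AdelicBRS.mem_brsVolumes_of_character _
      (AdelicBRS.continuous_angle ⟨γ, hγ⟩).measurable hv ?_
    rw [AdelicBRS.angle_proj_eq]
    exact (AdelicBRS.coe_eq_of_eq_add_int n hn).symm
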